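/- Let $I, X, Z, Y$ be the Pauli matrices on $\mathbb{C}^2$, labelled by $F_2^2$ as $\sigma_{00}=I$, $\sigma_{01}=X$, $\sigma_{10}=Z$, $\sigma_{11}=Y$, and for $\mathbf{m}=(m_1,\dots,m_N)\in F_2^{2N}$ with $m_n\in F_2^2$ put $\sigma_{\mathbf{m}}=\sigma_{m_1}\otimes\cdots\otimes\sigma_{m_N}$. An $N$-qubit stabilizer state is a unit vector $|\xi\rangle\in\mathbb{C}^{2^N}$ that is fixed by every element of a group $\langle g_1,\dots,g_N\rangle$, where $g_n\in\{\sigma_{\mathbf{s}(n)},-\sigma_{\mathbf{s}(n)}\}$, the $g_n$ commute pairwise, and $\mathbf{s}(1),\dots,\mathbf{s}(N)\in F_2^{2N}$ are linearly independent over $F_2$. For a probability vector $\mathbf{p}=(p_{00},p_{01},p_{10},p_{11})$ let $q_{\mathbf{m}}=\prod_{n=1}^N p_{m_n}$, let $H(\mathbf{p})=-\sum_{x\in F_2^2}p_x\log_2 p_x$ (with $0\log_2 0=0$), and let $$\eta^{(N)}(\mathbf{p},|\xi\rangle)=\max\Big\{\sum_{\mathbf{m}\in F_2^{2N}}q_{\mathbf{m}}\langle\xi|\sigma_{\mathbf{m}}B_{\mathbf{m}}\sigma_{\mathbf{m}}|\xi\rangle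 : \{B_{\mathbf{m}}\}_{\mathbf{m}\in F_2^{2N}}\text{ is a POVM on }\mathbb{C}^{2^N}\Big\}$$ be the optimal probability of exactly identifying an i.i.d. Pauli error with distribution $\mathbf{p}$ applied to $|\xi\rangle$. Theorem. If $H(\mathbf{p})<1$, then there exist $N$-qubit stabilizer states $|\xi^{(N)}\rangle\in\mathbb{C}^{2^N}$, $N\in\mathbb{N}$, such that $\lim_{N\to\infty}\eta^{(N)}(\mathbf{p},|\xi^{(N)}\rangle)=1$. -/

import Mathlib

open scoped Matrix ComplexOrder

noncomputable section

/-- The label set `F_2^2` of the single-qubit Pauli operators. -/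
abbrev PauliLabel : Type := ZMod 2 × ZMod 2

/-- The label set `F_2^{2N}`, seen as `N`-tuples `m = (m_1, …, m_N)` with `m_n ∈ F_2^2`;
it is a vector space over `F_2`. -/
abbrev PauliString (N : ℕ) : Type := Fin N → PauliLabel

/-- Labels `x = (x_1, …, x_N)` of the computational basis of `N` qubits. -/
abbrev QubitBasis (N : ℕ) : Type := Fin N → Fin 2

/-- Vectors of the `N`-qubit space `ℂ^{2^N} = (ℂ^2)^{⊗ N}`, in coordinates with respect to the
computational basis. The inner product of `φ` and `ψ` is `star φ ⬝ᵥ ψ`. -/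
abbrev QubitVec (N : ℕ) : Type := QubitBasis N → ℂ

/-- Operators on the `N`-qubit space, as matrices in the computational basis. -/
abbrev QubitOp (N : ℕ) : Type := Matrix (QubitBasis N) (QubitBasis N) ℂ

/-- The single-qubit Pauli operators `σ_00 = I`, `σ_01 = X`, `σ_10 = Z`, `σ_11 = Y`. -/
def pauliOne (m : PauliLabel) : Matrix (Fin 2) (Fin 2) ℂ :=
  if m = (0, 0) then 1
  else if m = (0, 1) then !![0, 1; 1, 0]
  else if m = (1, 0) then !![1, 0; 0, -1]
  else !![0, -Complex.I; Complex.I, 0]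

/-- The `N`-qubit Pauli operator `σ_m = σ_{m_1} ⊗ ⋯ ⊗ σ_{m_N}`. -/
def pauliOp {N : ℕ} (m : PauliString N) : QubitOp N :=
  Matrix.of fun x y => ∏ n, pauliOne (m n) (x n) (y n)

theorem pauliOne_conjTranspose (m : PauliLabel) : (pauliOne m)ᴴ = pauliOne m := by
  unfold pauliOne
  split_ifs
  · simp
  all_goals
    ext i j
    fin_cases i <;> fin_cases j <;> simp

theorem pauliOne_mul_self (m : PauliLabel) : pauliOne m * pauliOne m = 1 := by
  unfold pauliOne
  split_ifs
  · simp
  all_goals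
    ext i j
    fin_cases i <;> fin_cases j <;> simp

theorem pauliOp_conjTranspose {N : ℕ} (m : PauliString N) : (pauliOp m)ᴴ = pauliOp m := by
  ext x y
  simp only [Matrix.conjTranspose_apply, pauliOp, Matrix.of_apply, star_prod]
  refine Finset.prod_congr rfl fun n _ => ?_
  rw [← Matrix.conjTranspose_apply, pauliOne_conjTranspose]

theorem pauliOp_mul_self {N : ℕ} (m : PauliString N) : pauliOp m * pauliOp m = 1 := by
  ext x z
  simp only [Matrix.mul_apply, pauliOp, Matrix.of_apply, ← Finset.prod_mul_distrib]
  rw [← Fintype.prod_sum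
    (fun n (b : Fin 2) => pauliOne (m n) (x n) b * pauliOne (m n) b (z n))]
  simp only [← Matrix.mul_apply, pauliOne_mul_self, Matrix.one_apply]
  rw [Fintype.prod_ite_zero]
  simp [funext_iff]

/-- The `N`-qubit Pauli operator `σ_m` as an element of the unitary group. -/
def pauliUnitary {N : ℕ} (m : PauliString N) : Matrix.unitaryGroup (QubitBasis N) ℂ :=
  ⟨pauliOp m, by
    rw [Matrix.mem_unitaryGroup_iff, Matrix.star_eq_conjTranspose, pauliOp_conjTranspose,
      pauliOp_mul_self]⟩

/-- `ψ` is stabilized by the group `S` of operators: every element of `S` fixes `ψ`. -/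
def IsStabilizedBy {N : ℕ} (S : Subgroup (Matrix.unitaryGroup (QubitBasis N) ℂ))
    (ψ : QubitVec N) : Prop :=
  ∀ g ∈ S, (g : QubitOp N) *ᵥ ψ = ψ

/-- `ψ` is an `N`-qubit stabilizer state: a unit vector stabilized by a group
`⟨g_1, …, g_N⟩` with `g_n ∈ {σ_{s(n)}, -σ_{s(n)}}`, where the `g_n` commute pairwise and the
labels `s(1), …, s(N) ∈ F_2^{2N}` are linearly independent. -/
def IsStabilizerState {N : ℕ} (ψ : QubitVec N) : Prop :=
  star ψ ⬝ᵥ ψ = 1 ∧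
  ∃ (s : Fin N → PauliString N) (g : Fin N → Matrix.unitaryGroup (QubitBasis N) ℂ),
    (∀ n, g n = pauliUnitary (s n) ∨ g n = -pauliUnitary (s n)) ∧
    (∀ i j, Commute (g i) (g j)) ∧
    LinearIndependent (ZMod 2) s ∧
    IsStabilizedBy (Subgroup.closure (Set.range g)) ψ

/-- `B` is a positive-operator valued measure with outcomes in `F_2^{2N}`. -/
def IsPOVM {N : ℕ} (B : PauliString N → QubitOp N) : Prop :=
  (∀ m, (B m).PosSemidef) ∧ ∑ m, B m = 1

/-- The product distribution `q_m = p_{m_1} ⋯ p_{m_N}` on `F_2^{2N}`. -/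
def productProb (p : PauliLabel → ℝ) {N : ℕ} (m : PauliString N) : ℝ := ∏ n, p (m n)

/-- The probability `∑_m q_m ⟨ξ| σ_m B_m σ_m |ξ⟩` that the measurement `B` exactly identifies an
error `m` of distribution `q` applied to `ξ`. The complex number `⟨ξ| σ_m B_m σ_m |ξ⟩` is real
when `B_m` is positive semidefinite. -/
def successProb (p : PauliLabel → ℝ) {N : ℕ} (ξ : QubitVec N) (B : PauliString N → QubitOp N) :
    ℝ :=
  ∑ m, productProb p m * (star ξ ⬝ᵥ ((pauliOp m * B m * pauliOp m) *ᵥ ξ)).re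

/-- `η^{(N)}(p, ξ)`: the optimal success probability over all measurements. -/
def optimalSuccessProb (p : PauliLabel → ℝ) {N : ℕ} (ξ : QubitVec N) : ℝ :=
  sSup {r : ℝ | ∃ B : PauliString N → QubitOp N, IsPOVM B ∧ successProb p ξ B = r}

/-- The Shannon entropy in bits, `H(p) = -∑_x p_x log₂ p_x` (with `0 log₂ 0 = 0`). -/
def entropyBits (p : PauliLabel → ℝ) : ℝ := -∑ x, p x * Real.logb 2 (p x)

end

/-! The states are random graph states. A symmetric matrix `A` over `F_2` gives a stabilizer state
whose generators commute with an error up to signs, recorded by the syndrome `A x + z`, where `z`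
and `x` are the first and second components of the label. Errors with different syndromes send the
state to orthogonal vectors (`star_graphState_orthogonal`), so one measurement identifies every
error of a set with pairwise distinct syndromes.

Choose `a = 2 ^ c` with `H(p) < c < 1`. A Chernoff bound makes errors of probability below `a ^
(-N)` exponentially unlikely, and at most `a ^ N` errors remain. For uniformly random symmetric `A`,
two given errors share a syndrome with probability at most `2 ^ (-N)`
(`card_syndrome_eq_zero_mul_le`). By the union bound some `A` confuses typical errors of total
probability at most `(a / 2) ^ N`, which tends to zero. -/

/-! ### Commutation signs of Pauli operators -/

theorem zmod_two_eq_zero_or_one (a : ZMod 2) : a = 0 ∨ a = 1 := by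
  revert a
  decide

/-- The nontrivial character `a ↦ (-1)^a` of `F_2`. -/
noncomputable def signChar (a : ZMod 2) : ℂ := if a = 0 then 1 else -1

theorem signChar_add (a b : ZMod 2) : signChar (a + b) = signChar a * signChar b := by
  rcases zmod_two_eq_zero_or_one a with rfl | rfl <;>
    rcases zmod_two_eq_zero_or_one b with rfl | rfl <;>
    simp [signChar, CharTwo.add_self_eq_zero]

theorem prod_signChar {ι : Type*} (s : Finset ι) (f : ι → ZMod 2) :
    ∏ i ∈ s, signChar (f i) = signChar (∑ i ∈ s, f i) := by
  classical
  induction s using Finset.induction_on with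
  | empty => simp [signChar]
  | insert i s hi ih => rw [Finset.prod_insert hi, Finset.sum_insert hi, signChar_add, ih]

/-- The symplectic form on `F_2^{2N}`. -/
def sympForm {N : ℕ} (m m' : PauliString N) : ZMod 2 :=
  ∑ k, ((m k).1 * (m' k).2 + (m k).2 * (m' k).1)

theorem pauliOne_zero_zero : pauliOne (0, 0) = !![1, 0; 0, 1] := by
  simp [pauliOne, Matrix.one_fin_two]

theorem pauliOne_zero_one : pauliOne (0, 1) = !![0, 1; 1, 0] := by
  simp [pauliOne]

theorem pauliOne_one_zero : pauliOne (1, 0) = !![1, 0; 0, -1] := by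
  simp [pauliOne]

theorem pauliOne_one_one : pauliOne (1, 1) = !![0, -Complex.I; Complex.I, 0] := by
  simp [pauliOne]

theorem pauliOne_mul_comm (m m' : PauliLabel) :
    pauliOne m * pauliOne m' =
      signChar (m.1 * m'.2 + m.2 * m'.1) • (pauliOne m' * pauliOne m) := by
  obtain ⟨a, b⟩ := m
  obtain ⟨c, d⟩ := m'
  rcases zmod_two_eq_zero_or_one a with rfl | rfl <;>
    rcases zmod_two_eq_zero_or_one b with rfl | rfl <;>
    rcases zmod_two_eq_zero_or_one c with rfl | rfl <;>
    rcases zmod_two_eq_zero_or_one d with rfl | rfl <;>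
    simp [pauliOne_zero_zero, pauliOne_zero_one, pauliOne_one_zero, pauliOne_one_one, signChar,
      CharTwo.add_self_eq_zero]

theorem pauliOp_mul_comm {N : ℕ} (m m' : PauliString N) :
    pauliOp m * pauliOp m' = signChar (sympForm m m') • (pauliOp m' * pauliOp m) := by
  ext x z
  simp only [Matrix.smul_apply, Matrix.mul_apply, pauliOp, Matrix.of_apply,
    ← Finset.prod_mul_distrib]
  rw [← Fintype.prod_sum
    (fun n (b : Fin 2) => pauliOne (m n) (x n) b * pauliOne (m' n) b (z n)),
    ← Fintype.prod_sum
    (fun n (b : Fin 2) => pauliOne (m' n) (x n) b * pauliOne (m n) b (z n))]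
  simp only [← Matrix.mul_apply]
  rw [sympForm, ← prod_signChar, smul_eq_mul, ← Finset.prod_mul_distrib]
  refine Finset.prod_congr rfl fun k _ => ?_
  rw [pauliOne_mul_comm, Matrix.smul_apply, smul_eq_mul]

theorem star_pauliOp_mulVec_dotProduct {N : ℕ} (m : PauliString N) (φ ψ : QubitVec N) :
    star (pauliOp m *ᵥ φ) ⬝ᵥ ψ = star φ ⬝ᵥ (pauliOp m *ᵥ ψ) := by
  rw [Matrix.star_mulVec, pauliOp_conjTranspose, Matrix.dotProduct_mulVec]

/-- Errors that are distinguished by a Pauli operator stabilizing `ξ` map `ξ` to orthogonal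
vectors. -/
theorem star_dotProduct_eq_zero_of_sympForm_ne {N : ℕ} {s m m' : PauliString N} {ξ : QubitVec N}
    (hs : pauliOp s *ᵥ ξ = ξ) (h : sympForm s m ≠ sympForm s m') :
    star (pauliOp m *ᵥ ξ) ⬝ᵥ (pauliOp m' *ᵥ ξ) = 0 := by
  have key : ∀ l : PauliString N, pauliOp s *ᵥ (pauliOp l *ᵥ ξ) =
      signChar (sympForm s l) • (pauliOp l *ᵥ ξ) := by
    intro l
    rw [Matrix.mulVec_mulVec, pauliOp_mul_comm, Matrix.smul_mulVec, ← Matrix.mulVec_mulVec, hs]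
  -- `σ_s` is Hermitian and the two vectors are eigenvectors with opposite signs, so their inner
  -- product equals its own negative.
  have h1 := star_pauliOp_mulVec_dotProduct s (pauliOp m *ᵥ ξ) (pauliOp m' *ᵥ ξ)
  rw [key, key, star_smul, smul_dotProduct, dotProduct_smul, smul_eq_mul, smul_eq_mul] at h1
  generalize sympForm s m = a at h h1
  generalize sympForm s m' = b at h h1
  generalize star (pauliOp m *ᵥ ξ) ⬝ᵥ (pauliOp m' *ᵥ ξ) = w at h1 ⊢
  rcases zmod_two_eq_zero_or_one a with rfl | rfl <;>
    rcases zmod_two_eq_zero_or_one b with rfl | rfl <;>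
    simp [signChar] at h h1
  · linear_combination (1 / 2) * h1
  · linear_combination (-1 / 2) * h1

/-! ### Graph states and their syndromes -/

/-- The action of the second component of a Pauli label on the computational basis. -/
def flipBit (b : ZMod 2) (a : Fin 2) : Fin 2 := if b = 0 then a else 1 - a

theorem pauliOne_apply (m : PauliLabel) (a b : Fin 2) :
    pauliOne m a b =
      if b = flipBit m.2 a then
        (-1) ^ (m.1.val * a.val) * (-Complex.I) ^ (m.1.val * m.2.val) else 0 := by
  obtain ⟨c, d⟩ := m
  rcases zmod_two_eq_zero_or_one c with rfl | rfl <;>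
    rcases zmod_two_eq_zero_or_one d with rfl | rfl <;>
    fin_cases a <;> fin_cases b <;>
    simp [pauliOne_zero_zero, pauliOne_zero_one, pauliOne_one_zero, pauliOne_one_one, flipBit,
      ZMod.val_one]

theorem pauliOp_mulVec_apply {N : ℕ} (m : PauliString N) (ψ : QubitVec N) (x : QubitBasis N) :
    (pauliOp m *ᵥ ψ) x =
      (-1) ^ (∑ k, (m k).1.val * (x k).val) * (-Complex.I) ^ (∑ k, (m k).1.val * (m k).2.val) *
        ψ (fun k => flipBit (m k).2 (x k)) := by
  simp only [Matrix.mulVec, dotProduct, pauliOp, Matrix.of_apply, pauliOne_apply]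
  rw [Finset.sum_eq_single (fun k => flipBit (m k).2 (x k))]
  · simp only [if_true, Finset.prod_mul_distrib, Finset.prod_pow_eq_pow_sum]
  · intro y _ hy
    obtain ⟨k, hk⟩ := Function.ne_iff.mp hy
    rw [Finset.prod_eq_zero (Finset.mem_univ k) (if_neg hk), zero_mul]
  · simp

/-- The quadratic form `x ↦ xᵀ A x` with `0`-`1` entries lifted to the integers. -/
def graphPhase {N : ℕ} (A : Matrix (Fin N) (Fin N) (ZMod 2)) (x : Fin N → ℤ) : ℤ :=
  x ⬝ᵥ (A.map fun a => (a.val : ℤ)) *ᵥ x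

/-- Symmetry merges the two cross terms. For `d = ±1` the power of `I` thus changes by `(-1) ^ (A
x)_n * I ^ A_nn`, which the sign and the `-I` in the Pauli operator cancel. Powers of `I` depend on
the exponent mod 4, hence the lift to integers. -/
theorem graphPhase_add_smul_single {N : ℕ} {A : Matrix (Fin N) (Fin N) (ZMod 2)} (hA : A.IsSymm)
    (x : Fin N → ℤ) (n : Fin N) (d : ℤ) :
    graphPhase A (x + d • Pi.single n 1) =
      graphPhase A x + 2 * d * (∑ k, (A n k).val * x k) + d ^ 2 * (A n n).val := by
  set B : Matrix (Fin N) (Fin N) ℤ := A.map fun a => (a.val : ℤ) with hB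
  have hBs : Bᵀ = B := by rw [hB, ← Matrix.transpose_map, hA.eq]
  have e1 : Pi.single n 1 ⬝ᵥ B *ᵥ x = ∑ k, (A n k).val * x k := by
    rw [single_one_dotProduct]; rfl
  have e2 : x ⬝ᵥ B *ᵥ Pi.single n 1 = ∑ k, (A n k).val * x k := by
    rw [Matrix.dotProduct_mulVec, ← Matrix.mulVec_transpose, hBs, dotProduct_comm, e1]
  have e3 : (Pi.single n 1 : Fin N → ℤ) ⬝ᵥ B *ᵥ Pi.single n 1 = (A n n).val := by
    simp [hB]
  unfold graphPhase
  rw [← hB]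
  simp only [Matrix.mulVec_add, Matrix.mulVec_smul, add_dotProduct, dotProduct_add,
    smul_dotProduct, dotProduct_smul, e1, e2, e3, smul_eq_mul]
  ring

/-- The graph state with adjacency matrix `A`, where a diagonal entry stands for a phase gate. -/
noncomputable def graphState {N : ℕ} (A : Matrix (Fin N) (Fin N) (ZMod 2)) : QubitVec N := fun x =>
  ((√(2 ^ N))⁻¹ : ℝ) * Complex.I ^ graphPhase A fun k => ((x k).val : ℤ)

/-- The labels of the stabilizer generators of a graph state. -/
def graphLabel {N : ℕ} (A : Matrix (Fin N) (Fin N) (ZMod 2)) (n : Fin N) : PauliString N :=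
  fun k => (A n k, (Pi.single n 1 : Fin N → ZMod 2) k)

theorem star_graphState_dotProduct_self {N : ℕ} (A : Matrix (Fin N) (Fin N) (ZMod 2)) :
    star (graphState A) ⬝ᵥ graphState A = 1 := by
  have h : ∀ x, star (graphState A x) * graphState A x = ((2 ^ N)⁻¹ : ℝ) := by
    intro x
    rw [Complex.star_def, ← Complex.normSq_eq_conj_mul_self, Complex.normSq_eq_norm_sq, graphState]
    simp
  simp only [dotProduct, Pi.star_apply, h]
  simp

theorem pauliOp_graphLabel_mulVec {N : ℕ} {A : Matrix (Fin N) (Fin N) (ZMod 2)} (hA : A.IsSymm)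
    (n : Fin N) : pauliOp (graphLabel A n) *ᵥ graphState A = graphState A := by
  ext x
  rw [pauliOp_mulVec_apply]
  obtain ⟨d, hd, hx⟩ : ∃ d : ℤ, (d = 1 ∨ d = -1) ∧
      (fun k => ((flipBit (graphLabel A n k).2 (x k)).val : ℤ)) =
        (fun k => ((x k).val : ℤ)) + d • Pi.single n 1 := by
    -- Flipping bit `n` changes its integer value by `1` from `0` and by `-1` from `1`.
    refine ⟨1 - 2 * (x n).val, ?_, ?_⟩
    · generalize x n = a
      fin_cases a <;> simp
    · ext k
      by_cases hk : k = n
      · subst hk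
        simp only [graphLabel, Pi.single_eq_same, Pi.add_apply, Pi.smul_apply, smul_eq_mul]
        generalize x k = a
        fin_cases a <;> simp [flipBit]
      · simp only [graphLabel, Pi.single_eq_of_ne hk, Pi.add_apply, Pi.smul_apply, smul_eq_mul]
        generalize x k = a
        simp [flipBit]
  have hI : (Complex.I : ℂ) ≠ 0 := Complex.I_ne_zero
  have hd2 : d ^ 2 = 1 := by rcases hd with rfl | rfl <;> norm_num
  have hsq : Complex.I ^ (2 * d) = -1 := by
    rcases hd with rfl | rfl
    · norm_num [zpow_ofNat]
    · rw [show (2 * -1 : ℤ) = -2 by norm_num, zpow_neg, zpow_ofNat]; norm_num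
  have hsum : ∑ k, (graphLabel A n k).1.val * (graphLabel A n k).2.val = (A n n).val := by
    rw [Finset.sum_eq_single n]
    · simp [graphLabel, ZMod.val_one]
    · intro k _ hk
      simp [graphLabel, Pi.single_eq_of_ne hk]
    · simp
  have hcast : (∑ k, ((A n k).val : ℤ) * ((x k).val : ℤ)) =
      ((∑ k, (A n k).val * (x k).val : ℕ) : ℤ) := by push_cast; rfl
  simp only [graphState]
  rw [hx, graphPhase_add_smul_single hA, hd2, one_mul, hsum, hcast, zpow_add₀ hI, zpow_add₀ hI,
    zpow_mul, hsq, zpow_natCast, zpow_natCast]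
  simp only [graphLabel]
  generalize (∑ k, (A n k).val * (x k).val) = r
  generalize (A n n).val = t
  have h1 : ((-1 : ℂ) ^ r) * (-1) ^ r = 1 := by rw [← mul_pow]; norm_num
  have h2 : ((-Complex.I : ℂ) ^ t) * Complex.I ^ t = 1 := by rw [← mul_pow]; simp
  generalize (Complex.I ^ graphPhase A fun k => ((x k).val : ℤ)) = w
  linear_combination (((√(2 ^ N))⁻¹ : ℝ) * w : ℂ) * ((-Complex.I : ℂ) ^ t * Complex.I ^ t * h1 + h2)

/-- The error syndrome of the graph state with adjacency matrix `A`. -/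
def syndrome {N : ℕ} (A : Matrix (Fin N) (Fin N) (ZMod 2)) (m : PauliString N) :
    Fin N → ZMod 2 :=
  A *ᵥ (fun k => (m k).2) + fun k => (m k).1

theorem sympForm_graphLabel {N : ℕ} (A : Matrix (Fin N) (Fin N) (ZMod 2)) (n : Fin N)
    (m : PauliString N) : sympForm (graphLabel A n) m = syndrome A m n := by
  simp [sympForm, graphLabel, syndrome, Finset.sum_add_distrib, Matrix.mulVec, dotProduct,
    Pi.single_apply]

theorem isStabilizerState_graphState {N : ℕ} {A : Matrix (Fin N) (Fin N) (ZMod 2)}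
    (hA : A.IsSymm) : IsStabilizerState (graphState A) := by
  refine ⟨star_graphState_dotProduct_self A, graphLabel A, fun n => pauliUnitary (graphLabel A n),
    fun n => Or.inl rfl, fun i j => ?_, ?_, ?_⟩
  · have h0 : sympForm (graphLabel A i) (graphLabel A j) = 0 := by
      rw [sympForm_graphLabel]
      simp [syndrome, graphLabel, hA.apply i j, CharTwo.add_self_eq_zero]
    refine Subtype.ext ?_
    change pauliOp _ * pauliOp _ = pauliOp _ * pauliOp _
    rw [pauliOp_mul_comm, h0, signChar, if_pos rfl, one_smul]
  · let f : PauliString N →ₗ[ZMod 2] (Fin N → ZMod 2) :=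
      { toFun := fun m k => (m k).2
        map_add' := fun _ _ => rfl
        map_smul' := fun _ _ => rfl }
    refine LinearIndependent.of_comp f ?_
    convert (Pi.basisFun (ZMod 2) (Fin N)).linearIndependent using 1
    ext n k
    simp [f, graphLabel]
  · intro g hg
    induction hg using Subgroup.closure_induction with
    | mem g hg =>
      obtain ⟨n, rfl⟩ := hg
      exact pauliOp_graphLabel_mulVec hA n
    | one => simp
    | mul a b _ _ ha hb =>
      rw [Submonoid.coe_mul, ← Matrix.mulVec_mulVec, hb, ha]
    | inv a _ ha =>
      have h1 : ((a⁻¹ : Matrix.unitaryGroup (QubitBasis N) ℂ) : QubitOp N) * (a : QubitOp N) = 1 := by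
        rw [← Submonoid.coe_mul, inv_mul_cancel, Submonoid.coe_one]
      rw [← ha, Matrix.mulVec_mulVec, h1, Matrix.one_mulVec, ha]

theorem star_graphState_orthogonal {N : ℕ} {A : Matrix (Fin N) (Fin N) (ZMod 2)}
    (hA : A.IsSymm) {m m' : PauliString N} (h : syndrome A m ≠ syndrome A m') :
    star (pauliOp m *ᵥ graphState A) ⬝ᵥ (pauliOp m' *ᵥ graphState A) = 0 := by
  obtain ⟨n, hn⟩ := Function.ne_iff.mp h
  rw [← sympForm_graphLabel, ← sympForm_graphLabel] at hn
  exact star_dotProduct_eq_zero_of_sympForm_ne (pauliOp_graphLabel_mulVec hA n) hn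

/-! ### Bounds on the optimal success probability -/

theorem productProb_nonneg {p : PauliLabel → ℝ} (hp : ∀ x, 0 ≤ p x) {N : ℕ} (m : PauliString N) :
    0 ≤ productProb p m :=
  Finset.prod_nonneg fun _ _ => hp _

theorem sum_productProb {p : PauliLabel → ℝ} (hp : ∑ x, p x = 1) (N : ℕ) :
    ∑ m : PauliString N, productProb p m = 1 := by
  simp only [productProb]
  rw [← Fintype.prod_sum (fun (_ : Fin N) x => p x)]
  simp [hp]

theorem star_dotProduct_conj_pauliOp {N : ℕ} (m : PauliString N) (B : QubitOp N)
    (ξ : QubitVec N) :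
    star ξ ⬝ᵥ ((pauliOp m * B * pauliOp m) *ᵥ ξ) =
      star (pauliOp m *ᵥ ξ) ⬝ᵥ (B *ᵥ (pauliOp m *ᵥ ξ)) := by
  rw [Matrix.star_mulVec, pauliOp_conjTranspose, ← Matrix.dotProduct_mulVec,
    Matrix.mulVec_mulVec, Matrix.mulVec_mulVec, mul_assoc]

theorem star_pauliOp_mulVec_dotProduct_self {N : ℕ} (m : PauliString N) (ξ : QubitVec N) :
    star (pauliOp m *ᵥ ξ) ⬝ᵥ (pauliOp m *ᵥ ξ) = star ξ ⬝ᵥ ξ := by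
  rw [Matrix.star_mulVec, pauliOp_conjTranspose, ← Matrix.dotProduct_mulVec,
    Matrix.mulVec_mulVec, pauliOp_mul_self, Matrix.one_mulVec]

theorem successProb_le_one {p : PauliLabel → ℝ} (hp : ∀ x, 0 ≤ p x) (hp1 : ∑ x, p x = 1) {N : ℕ}
    {ξ : QubitVec N} (hξ : star ξ ⬝ᵥ ξ = 1) {B : PauliString N → QubitOp N} (hB : IsPOVM B) :
    successProb p ξ B ≤ 1 := by
  rw [← sum_productProb hp1 N, successProb]
  refine Finset.sum_le_sum fun m _ => mul_le_of_le_one_right (productProb_nonneg hp m) ?_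
  rw [star_dotProduct_conj_pauliOp]
  set φ := pauliOp m *ᵥ ξ with hφ
  have h1 : ∑ l, (star φ ⬝ᵥ (B l *ᵥ φ)).re = 1 := by
    rw [← Complex.re_sum, ← dotProduct_sum, ← Matrix.sum_mulVec, hB.2, Matrix.one_mulVec, hφ,
      star_pauliOp_mulVec_dotProduct_self, hξ, Complex.one_re]
  rw [← h1]
  exact Finset.single_le_sum (f := fun l => (star φ ⬝ᵥ (B l *ᵥ φ)).re)
    (fun l _ => (Complex.nonneg_iff.mp ((hB.1 l).dotProduct_mulVec_nonneg φ)).1)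
    (Finset.mem_univ m)

theorem optimalSuccessProb_le_one {p : PauliLabel → ℝ} (hp : ∀ x, 0 ≤ p x) (hp1 : ∑ x, p x = 1)
    {N : ℕ} {ξ : QubitVec N} (hξ : star ξ ⬝ᵥ ξ = 1) : optimalSuccessProb p ξ ≤ 1 :=
  Real.sSup_le (by rintro _ ⟨B, hB, rfl⟩; exact successProb_le_one hp hp1 hξ hB) zero_le_one

/-- Measuring in an orthonormal family `σ_m ξ`, `m ∈ T`, identifies every error in `T`. -/
theorem sum_productProb_le_optimalSuccessProb {p : PauliLabel → ℝ} (hp : ∀ x, 0 ≤ p x)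
    (hp1 : ∑ x, p x = 1) {N : ℕ} {ξ : QubitVec N} (hξ : star ξ ⬝ᵥ ξ = 1)
    (T : Finset (PauliString N))
    (hT : ∀ m ∈ T, ∀ m' ∈ T, m ≠ m' → star (pauliOp m *ᵥ ξ) ⬝ᵥ (pauliOp m' *ᵥ ξ) = 0) :
    ∑ m ∈ T, productProb p m ≤ optimalSuccessProb p ξ := by
  classical
  set φ : PauliString N → QubitVec N := fun m => pauliOp m *ᵥ ξ with hφ
  have hφ1 : ∀ m, star (φ m) ⬝ᵥ φ m = 1 := fun m => by
    rw [hφ, star_pauliOp_mulVec_dotProduct_self, hξ]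
  set E : PauliString N → QubitOp N := fun m => Matrix.vecMulVec (φ m) (star (φ m)) with hE
  have hEpos : ∀ m, (E m).PosSemidef := fun m => Matrix.posSemidef_vecMulVec_self_star _
  set P : QubitOp N := ∑ m ∈ T, E m with hP
  have hPH : Pᴴ = P := by
    rw [hP, Matrix.conjTranspose_sum]
    exact Finset.sum_congr rfl fun m _ => (hEpos m).isHermitian
  have hPP : P * P = P := by
    rw [hP, Finset.sum_mul]
    refine Finset.sum_congr rfl fun m hm => ?_
    rw [Finset.mul_sum, Finset.sum_eq_single m]
    · simp [hE, Matrix.vecMulVec_mul_vecMulVec, hφ1]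
    · intro m' hm' hne
      simp [hE, Matrix.vecMulVec_mul_vecMulVec, hφ, hT m hm m' hm' hne.symm]
    · exact fun h => absurd hm h
  have hR : (1 - P).PosSemidef := by
    have h : 1 - P = (1 - P)ᴴ * (1 - P) := by
      rw [Matrix.conjTranspose_sub, Matrix.conjTranspose_one, hPH]
      rw [sub_mul, mul_sub, mul_sub, hPP, one_mul, mul_one, one_mul, sub_self, sub_zero]
    rw [h]
    exact Matrix.posSemidef_conjTranspose_mul_self _
  -- The leftover projection `1 - P` completes the POVM; assigning it to outcome `0` can only add
  -- success probability.
  set B : PauliString N → QubitOp N := fun m =>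
    (if m ∈ T then E m else 0) + (if m = 0 then 1 - P else 0) with hB
  have hpart : ∀ m : PauliString N, (if m = 0 then 1 - P else 0 : QubitOp N).PosSemidef := fun m => by
    split_ifs
    exacts [hR, Matrix.PosSemidef.zero]
  have hPOVM : IsPOVM B := by
    refine ⟨fun m => Matrix.PosSemidef.add ?_ (hpart m), ?_⟩
    · split_ifs
      exacts [hEpos m, Matrix.PosSemidef.zero]
    · rw [hB, Finset.sum_add_distrib, Finset.sum_ite_mem, Finset.univ_inter]
      simp [← hP]
  have hbdd : BddAbove {r : ℝ | ∃ B : PauliString N → QubitOp N,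
      IsPOVM B ∧ successProb p ξ B = r} :=
    ⟨1, by rintro _ ⟨B, hB, rfl⟩; exact successProb_le_one hp hp1 hξ hB⟩
  refine le_trans ?_ (le_csSup hbdd ⟨B, hPOVM, rfl⟩)
  rw [successProb, ← Finset.univ_inter T, ← Finset.sum_ite_mem]
  refine Finset.sum_le_sum fun m _ => ?_
  rw [star_dotProduct_conj_pauliOp]
  have hnn : 0 ≤ (star (φ m) ⬝ᵥ (B m *ᵥ φ m)).re :=
    (Complex.nonneg_iff.mp ((hPOVM.1 m).dotProduct_mulVec_nonneg (φ m))).1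
  split_ifs with hm
  · refine le_mul_of_one_le_right (productProb_nonneg hp m) ?_
    change 1 ≤ (star (φ m) ⬝ᵥ (B m *ᵥ φ m)).re
    have h1 : star (φ m) ⬝ᵥ (E m *ᵥ φ m) = 1 := by
      simp [hE, Matrix.vecMulVec_mulVec, hφ1]
    simp only [hB, if_pos hm, Matrix.add_mulVec, dotProduct_add, Complex.add_re, h1,
      Complex.one_re]
    have := (Complex.nonneg_iff.mp ((hpart m).dotProduct_mulVec_nonneg (φ m))).1
    linarith
  · exact mul_nonneg (productProb_nonneg hp m) hnn

/-! ### Typical errors -/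

/-- If `∑ x, p x * log (p x * a) > 0` then the errors of probability below `a ^ (-N)` have
exponentially small total probability. -/
theorem exists_sum_productProb_atypical_le {p : PauliLabel → ℝ} (hp : ∀ x, 0 ≤ p x)
    (hp1 : ∑ x, p x = 1) {a : ℝ} (ha : 0 < a) (h : 0 < ∑ x, p x * Real.log (p x * a)) :
    ∃ r : ℝ, 0 ≤ r ∧ r < 1 ∧ ∀ N : ℕ,
      ∑ m : PauliString N with productProb p m * a ^ N < 1, productProb p m ≤ r ^ N := by
  -- Moment generating function of `-log (p x * a)`: `g 0 = 1` and `g' 0 < 0`, so `g t < 1` for some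
  -- `t > 0`. Independence gives `g t ^ N` as the mean of `(q_m * a ^ N) ^ (-t)`, which is at least
  -- `1` at atypical `m` with `q_m > 0`.
  set g : ℝ → ℝ := fun t => ∑ x, p x * (p x * a) ^ (-t) with hg
  have hg0 : g 0 = 1 := by simp [hg, hp1]
  have hderiv : HasDerivAt g (∑ x, p x * -Real.log (p x * a)) 0 := by
    refine HasDerivAt.fun_sum fun x _ => ?_
    rcases (hp x).eq_or_lt with h0 | h0
    -- Where `p x = 0` the summand vanishes for every `t`.
    · simpa [← h0] using hasDerivAt_const (0 : ℝ) (0 : ℝ)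
    · refine HasDerivAt.const_mul _ ?_
      have := (Real.hasStrictDerivAt_const_rpow (mul_pos h0 ha) (-0)).hasDerivAt.comp (0 : ℝ)
        (hasDerivAt_neg (0 : ℝ))
      simpa [Function.comp_def] using this
  obtain ⟨t, ht0, ht⟩ : ∃ t : ℝ, 0 < t ∧ g t < 1 := by
    have hneg : (∑ x, p x * -Real.log (p x * a)) < 0 := by
      simpa [Finset.sum_neg_distrib] using h
    have h1 := (hasDerivAt_iff_tendsto_slope.mp hderiv).eventually (gt_mem_nhds hneg)
    have h2 : ∀ᶠ t in nhdsWithin (0 : ℝ) (Set.Ioi 0), slope g 0 t < 0 :=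
      h1.filter_mono (nhdsWithin_mono _ fun t ht => ne_of_gt ht)
    obtain ⟨t, ht, ht0⟩ := (h2.and self_mem_nhdsWithin).exists
    refine ⟨t, ht0, ?_⟩
    rw [slope_def_field, hg0, sub_zero, div_neg_iff] at ht
    have ht0' : (0 : ℝ) < t := ht0
    rcases ht with ht | ht <;> linarith [ht.1, ht.2]
  refine ⟨g t, Finset.sum_nonneg fun x _ =>
    mul_nonneg (hp x) (Real.rpow_nonneg (mul_nonneg (hp x) ha.le) _), ht, fun N => ?_⟩
  have hterm : ∀ m : PauliString N, ∏ n, (p (m n) * (p (m n) * a) ^ (-t)) =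
      productProb p m * (productProb p m * a ^ N) ^ (-t) := by
    intro m
    rw [Finset.prod_mul_distrib, Real.finsetProd_rpow _ _
      (fun n _ => mul_nonneg (hp _) ha.le), Finset.prod_mul_distrib]
    simp [productProb]
  have hpow : g t ^ N = ∑ m : PauliString N,
      productProb p m * (productProb p m * a ^ N) ^ (-t) := by
    rw [← Finset.sum_congr rfl fun m _ => hterm m,
      ← Fintype.prod_sum (fun (_ : Fin N) x => p x * (p x * a) ^ (-t))]
    simp [hg]
  have hnn : ∀ m : PauliString N, 0 ≤ productProb p m * (productProb p m * a ^ N) ^ (-t) :=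
    fun m => mul_nonneg (productProb_nonneg hp m)
      (Real.rpow_nonneg (mul_nonneg (productProb_nonneg hp m) (pow_nonneg ha.le N)) _)
  rw [hpow]
  refine le_trans (Finset.sum_le_sum fun m hm => ?_)
    (Finset.sum_le_sum_of_subset_of_nonneg (Finset.subset_univ _) fun m _ _ => hnn m)
  rcases (productProb_nonneg hp m).eq_or_lt with h0 | h0
  · simp [← h0]
  · refine le_mul_of_one_le_right h0.le ?_
    exact Real.one_le_rpow_of_pos_of_le_one_of_nonpos (by positivity)
      (Finset.mem_filter.mp hm).2.le (by linarith)

/-- Each counted error has weight at least `1` under `q_m * a ^ N`, of total mass `a ^ N`. -/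
theorem card_typical_le {p : PauliLabel → ℝ} (hp : ∀ x, 0 ≤ p x) (hp1 : ∑ x, p x = 1) {a : ℝ}
    (ha : 0 < a) (N : ℕ) :
    (({m : PauliString N | ¬ productProb p m * a ^ N < 1} : Finset (PauliString N)).card : ℝ)
      ≤ a ^ N := by
  rw [Finset.card_eq_sum_ones, Nat.cast_sum]
  calc _ ≤ ∑ m : PauliString N with ¬ productProb p m * a ^ N < 1, productProb p m * a ^ N :=
        Finset.sum_le_sum fun m hm => by
          simpa using (Finset.mem_filter.mp hm).2
    _ ≤ ∑ m : PauliString N, productProb p m * a ^ N :=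
        Finset.sum_le_sum_of_subset_of_nonneg (Finset.subset_univ _) fun m _ _ =>
          mul_nonneg (productProb_nonneg hp m) (pow_nonneg ha.le N)
    _ = a ^ N := by rw [← Finset.sum_mul, sum_productProb hp1, one_mul]

theorem exists_typicality_base {p : PauliLabel → ℝ} (hp : ∀ x, 0 ≤ p x) (hp1 : ∑ x, p x = 1)
    (hH : entropyBits p < 1) :
    ∃ a : ℝ, 0 < a ∧ a < 2 ∧ 0 < ∑ x, p x * Real.log (p x * a) := by
  obtain ⟨c, hc1, hc2⟩ := exists_between hH
  have hlog2 : 0 < Real.log 2 := Real.log_pos one_lt_two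
  -- With this base the sum equals `log 2 * (c - H(p))`.
  refine ⟨2 ^ c, by positivity, ?_, ?_⟩
  · simpa using Real.rpow_lt_rpow_of_exponent_lt one_lt_two hc2
  · have h : ∀ x, p x * Real.log (p x * 2 ^ c) =
        Real.log 2 * (p x * Real.logb 2 (p x)) + p x * (c * Real.log 2) := by
      intro x
      rcases (hp x).eq_or_lt with h0 | h0
      · simp [← h0]
      · rw [Real.log_mul h0.ne' (by positivity), Real.log_rpow two_pos, Real.logb]
        field_simp
    rw [Finset.sum_congr rfl fun x _ => h x, Finset.sum_add_distrib, ← Finset.mul_sum,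
      ← Finset.sum_mul, hp1]
    unfold entropyBits at hc1
    nlinarith

/-! ### Random symmetric matrices and syndrome collisions -/

theorem syndrome_sub {N : ℕ} (A : Matrix (Fin N) (Fin N) (ZMod 2)) (m m' : PauliString N) :
    syndrome A (m - m') = syndrome A m - syndrome A m' := by
  have h : (fun k => ((m - m') k).2) = (fun k => (m k).2) - fun k => (m' k).2 := rfl
  rw [syndrome, h, Matrix.mulVec_sub, syndrome, syndrome]
  ext k
  simp only [Pi.add_apply, Pi.sub_apply, Prod.fst_sub]
  ring

theorem exists_isSymm_mulVec_eq {N : ℕ} {w : Fin N → ZMod 2} (hw : w ≠ 0) (u : Fin N → ZMod 2) :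
    ∃ R : Matrix (Fin N) (Fin N) (ZMod 2), R.IsSymm ∧ R *ᵥ w = u := by
  obtain ⟨i, hi⟩ := Function.ne_iff.mp hw
  have hi1 : w i = 1 := by
    rw [Pi.zero_apply] at hi
    generalize w i = a at hi
    revert a
    decide
  let e : Fin N → ZMod 2 := Pi.single i 1
  have he : e ⬝ᵥ w = 1 := by simp [e, hi1]
  -- The symmetrized rank-one matrix sends `w` to `u + (u ⬝ᵥ w) • e`; the last term removes the
  -- excess.
  refine ⟨Matrix.vecMulVec u e + Matrix.vecMulVec e u - (u ⬝ᵥ w) • Matrix.vecMulVec e e, ?_, ?_⟩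
  · rw [Matrix.IsSymm]
    simp only [Matrix.transpose_sub, Matrix.transpose_add, Matrix.transpose_smul,
      Matrix.transpose_vecMulVec]
    rw [add_comm (Matrix.vecMulVec e u)]
  · simp [Matrix.sub_mulVec, Matrix.add_mulVec, Matrix.smul_mulVec, Matrix.vecMulVec_mulVec, he]

/-- A fixed nontrivial error has trivial syndrome for at most a fraction `2 ^ (-N)` of all
symmetric adjacency matrices. -/
theorem card_syndrome_eq_zero_mul_le {N : ℕ} {v : PauliString N} (hv : v ≠ 0) :
    (({A | A.IsSymm ∧ syndrome A v = 0} : Finset (Matrix (Fin N) (Fin N) (ZMod 2))).card) * 2 ^ N ≤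
      ({A | A.IsSymm} : Finset (Matrix (Fin N) (Fin N) (ZMod 2))).card := by
  classical
  set w : Fin N → ZMod 2 := fun k => (v k).2 with hwdef
  by_cases hw : w = 0
  · have hz : (fun k => (v k).1) ≠ 0 := fun hz =>
      hv (funext fun k => Prod.ext (congrFun hz k) (congrFun hw k))
    have : ({A | A.IsSymm ∧ syndrome A v = 0} : Finset (Matrix (Fin N) (Fin N) (ZMod 2))) = ∅ := by
      refine Finset.filter_eq_empty_iff.mpr fun A _ hA => hz ?_
      have := hA.2
      rwa [syndrome, ← hwdef, hw, Matrix.mulVec_zero, zero_add] at this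
    simp [this]
  · choose R hRs hRw using exists_isSymm_mulVec_eq hw
    have hc : (Finset.univ : Finset (Fin N → ZMod 2)).card = 2 ^ N := by
      simp [ZMod.card]
    rw [← hc, ← Finset.card_product]
    -- All `A` with trivial syndrome agree on `w`, so `(A + R u) *ᵥ w` determines `u`, and then `A`.
    refine Finset.card_le_card_of_injOn (fun q => q.1 + R q.2) ?_ ?_
    · rintro ⟨A, u⟩ hq
      simp only [Finset.coe_product, Set.mem_prod, Finset.mem_coe, Finset.mem_filter] at hq
      simpa using hq.1.2.1.add (hRs u)
    · rintro ⟨A, u⟩ hq ⟨A', u'⟩ hq' h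
      simp only [Finset.coe_product, Set.mem_prod, Finset.mem_coe, Finset.mem_filter] at hq hq'
      have h1 : A *ᵥ w = A' *ᵥ w :=
        add_right_cancel (hq.1.2.2.trans hq'.1.2.2.symm)
      have h2 := congrArg (· *ᵥ w) h
      simp only [Matrix.add_mulVec, hRw, h1] at h2
      have hu : u = u' := add_left_cancel h2
      subst hu
      exact Prod.ext (add_right_cancel h) rfl

/-- For every set `T` of errors there is a graph state whose syndrome separates the errors in `T`,
up to a set of errors of probability at most `|T| / 2 ^ N`. -/
theorem exists_isSymm_sum_confused_le {p : PauliLabel → ℝ} (hp : ∀ x, 0 ≤ p x)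
    (hp1 : ∑ x, p x = 1) {N : ℕ} (T : Finset (PauliString N)) :
    ∃ A : Matrix (Fin N) (Fin N) (ZMod 2), A.IsSymm ∧
      ∑ m ∈ T with ∃ m' ∈ T, m' ≠ m ∧ syndrome A m' = syndrome A m, productProb p m ≤
        T.card / 2 ^ N := by
  classical
  set S : Finset (Matrix (Fin N) (Fin N) (ZMod 2)) := {A | A.IsSymm} with hS
  have hSne : S.Nonempty := ⟨0, by simp [hS]⟩
  have hpair : ∀ m m' : PauliString N, m' ≠ m →
      ∑ A ∈ S, (if syndrome A m' = syndrome A m then 1 else 0 : ℝ) ≤ S.card / 2 ^ N := by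
    intro m m' hne
    rw [le_div_iff₀ (by positivity), Finset.sum_boole, hS, Finset.filter_filter]
    have := card_syndrome_eq_zero_mul_le (sub_ne_zero.mpr hne)
    simp only [syndrome_sub, sub_eq_zero] at this
    exact_mod_cast this
  have hbound : ∀ A, ∑ m ∈ T with ∃ m' ∈ T, m' ≠ m ∧ syndrome A m' = syndrome A m,
      productProb p m ≤ ∑ m ∈ T, productProb p m *
        ∑ m' ∈ T with m' ≠ m, (if syndrome A m' = syndrome A m then 1 else 0 : ℝ) := by
    intro A
    rw [Finset.sum_filter]
    refine Finset.sum_le_sum fun m _ => ?_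
    have hnn : ∀ m' ∈ ({m' ∈ T | m' ≠ m} : Finset _),
        (0 : ℝ) ≤ if syndrome A m' = syndrome A m then 1 else 0 := fun m' _ => by
      split_ifs <;> norm_num
    split_ifs with h
    · obtain ⟨m', hm', hne, heq⟩ := h
      refine le_mul_of_one_le_right (productProb_nonneg hp m) ?_
      refine le_trans (by rw [if_pos heq]) (Finset.single_le_sum hnn
        (Finset.mem_filter.mpr ⟨hm', hne⟩))
    · exact mul_nonneg (productProb_nonneg hp m) (Finset.sum_nonneg hnn)
  have havg : ∑ A ∈ S, ∑ m ∈ T with ∃ m' ∈ T, m' ≠ m ∧ syndrome A m' = syndrome A m,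
      productProb p m ≤ ∑ _A ∈ S, (T.card / 2 ^ N : ℝ) := by
    calc _ ≤ ∑ A ∈ S, ∑ m ∈ T, productProb p m *
        ∑ m' ∈ T with m' ≠ m, (if syndrome A m' = syndrome A m then 1 else 0 : ℝ) :=
          Finset.sum_le_sum fun A _ => hbound A
      _ = ∑ m ∈ T, productProb p m * ∑ m' ∈ T with m' ≠ m,
          ∑ A ∈ S, (if syndrome A m' = syndrome A m then 1 else 0 : ℝ) := by
          rw [Finset.sum_comm]
          refine Finset.sum_congr rfl fun m _ => ?_
          rw [← Finset.mul_sum, Finset.sum_comm]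
      _ ≤ ∑ m ∈ T, productProb p m * (T.card * (S.card / 2 ^ N)) := by
          refine Finset.sum_le_sum fun m _ =>
            mul_le_mul_of_nonneg_left ?_ (productProb_nonneg hp m)
          refine (Finset.sum_le_sum fun m' hm' =>
            hpair m m' (Finset.mem_filter.mp hm').2).trans ?_
          rw [Finset.sum_const, nsmul_eq_mul]
          gcongr
          exact Finset.filter_subset _ _
      _ ≤ 1 * (T.card * (S.card / 2 ^ N)) := by
          rw [← Finset.sum_mul]
          gcongr
          rw [← sum_productProb hp1 N]
          exact Finset.sum_le_sum_of_subset_of_nonneg (Finset.subset_univ _)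
            fun m _ _ => productProb_nonneg hp m
      _ = _ := by rw [Finset.sum_const, nsmul_eq_mul]; ring
  -- Some symmetric matrix does no worse than the average.
  obtain ⟨A, hA, h⟩ := Finset.exists_le_of_sum_le hSne havg
  exact ⟨A, (Finset.mem_filter.mp hA).2, h⟩

/-! ### Combining the two error bounds -/

theorem exists_graphState_optimalSuccessProb_ge {p : PauliLabel → ℝ} (hp : ∀ x, 0 ≤ p x)
    (hp1 : ∑ x, p x = 1) {a : ℝ} (ha : 0 < a) (N : ℕ) :
    ∃ A : Matrix (Fin N) (Fin N) (ZMod 2), A.IsSymm ∧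
      1 - ∑ m : PauliString N with productProb p m * a ^ N < 1, productProb p m - (a / 2) ^ N ≤
        optimalSuccessProb p (graphState A) := by
  classical
  set T : Finset (PauliString N) := {m | ¬ productProb p m * a ^ N < 1} with hTdef
  obtain ⟨A, hA, hconf⟩ := exists_isSymm_sum_confused_le hp hp1 T
  refine ⟨A, hA, ?_⟩
  have hcard : (T.card : ℝ) / 2 ^ N ≤ (a / 2) ^ N := by
    rw [div_pow]
    gcongr
    exact card_typical_le hp hp1 ha N
  have hsplit := Finset.sum_filter_add_sum_filter_not (Finset.univ : Finset (PauliString N))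
    (fun m => productProb p m * a ^ N < 1) (productProb p)
  rw [sum_productProb hp1, ← hTdef] at hsplit
  have hsplit' := Finset.sum_filter_add_sum_filter_not T
    (fun m => ∃ m' ∈ T, m' ≠ m ∧ syndrome A m' = syndrome A m) (productProb p)
  have hopt := sum_productProb_le_optimalSuccessProb hp hp1 (star_graphState_dotProduct_self A)
    {m ∈ T | ¬ ∃ m' ∈ T, m' ≠ m ∧ syndrome A m' = syndrome A m} (by
      intro m hm m' hm' hne
      refine star_graphState_orthogonal hA fun heq => ?_
      exact (Finset.mem_filter.mp hm').2 ⟨m, (Finset.mem_filter.mp hm).1, hne, heq⟩)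
  linarith

theorem theorem2 (p : PauliLabel → ℝ) (hp_nonneg : ∀ x, 0 ≤ p x) (hp_sum : ∑ x, p x = 1)
    (hH : entropyBits p < 1) :
    ∃ ξ : (N : ℕ) → QubitVec N,
      (∀ N, IsStabilizerState (ξ N)) ∧
      Filter.Tendsto (fun N : ℕ => optimalSuccessProb p (ξ N)) Filter.atTop (nhds 1) := by
  obtain ⟨a, ha, ha2, hlog⟩ := exists_typicality_base hp_nonneg hp_sum hH
  obtain ⟨r, hr0, hr1, hr⟩ := exists_sum_productProb_atypical_le hp_nonneg hp_sum ha hlog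
  choose A hA hopt using exists_graphState_optimalSuccessProb_ge hp_nonneg hp_sum ha
  refine ⟨fun N => graphState (A N), fun N => isStabilizerState_graphState (hA N), ?_⟩
  have hlim : Filter.Tendsto (fun N : ℕ => 1 - r ^ N - (a / 2) ^ N) Filter.atTop (nhds 1) := by
    have h1 := tendsto_pow_atTop_nhds_zero_of_lt_one hr0 hr1
    have h2 := tendsto_pow_atTop_nhds_zero_of_lt_one (r := a / 2) (by positivity) (by linarith)
    simpa using (h1.const_sub 1).sub h2
  refine tendsto_of_tendsto_of_tendsto_of_le_of_le hlim tendsto_const_nhds (fun N => ?_)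
    (fun N => optimalSuccessProb_le_one hp_nonneg hp_sum (star_graphState_dotProduct_self _))
  have h1 := hopt N
  have h2 := hr N
  change 1 - r ^ N - (a / 2) ^ N ≤ optimalSuccessProb p (graphState (A N))
  linarith
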